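/- Let $k$ and $r$ be integers with $k \ge 2$ and $k \ge r \ge 1$, and let $G$ be a simple undirected graph. If $G$ contains no cycle whose length is congruent to $r$ modulo $k$, then $G$ is $k$-colorable if $r \ne 2$, and $(k+1)$-colorable if $r = 2$. Here a cycle is a closed walk of length at least $3$ with no repeated edge and no repeated vertex other than its endpoint, and a graph is $m$-colorable if its vertices can be assigned $m$ colors so that adjacent vertices receive different colors. -/

import Mathlib

/-!
If a finite set of vertices is not colourable with `m` colours, it contains a critical set, all of
whose proper subsets are colourable. Critical sets are `2`-connected
(`IsCriticalOn.exists_adj_of_ssubset_erase`), and every colouring of a critical set minus a vertex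
`v` uses all colours on the neighbours of `v` (`IsCriticalOn.exists_adj_color_eq`).

The key fact is that in a set `s` critical for `k` colours, any two vertices `a ≠ v` are joined by
paths of every length modulo `k` (`IsCriticalOn.exists_isPath_length_eq`). Colour `s \ {v}` with
`ZMod k` and let `S` be the set of vertices reached from `a` by walks along which the colour grows
by one at each step. Adding one to the colours on `S` keeps the colouring proper and does not shrink
`S`; repeating this, `S` grows until it is all of the connected set `s \ {v}`
(`IsColoringOn.exists_forall_exists_isPath`). Then the length of the path from `a` to a neighbour
`y` of `v` is determined modulo `k` by the colour of `y`, and all colours are available.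

If `r ≠ 2` and `G` is not `k`-colourable, take `a` adjacent to `v` and close a path of length
congruent to `r - 1` by the edge `va`, which is not on the path since `r - 1 ≠ 1`. If `G` is not
even `(k + 1)`-colourable, a set critical for `k` colours lies strictly inside a set critical for
`k + 1` colours, so by `2`-connectedness it has an ear (`IsCriticalOn.exists_ear`), and closing the
ear by a path of suitable length gives cycles of every length modulo `k`. Infinite graphs are
reduced to finite vertex sets by compactness (`colorable_of_forall_finset`).
-/

namespace SimpleGraph

variable {V : Type*} (G : SimpleGraph V)

/-! ### Colourings of vertex sets and critical sets -/

/-- `c` gives different colours to any two adjacent vertices of `s`; its values outside `s` are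
irrelevant. Working with total functions avoids passing to induced subgraphs. -/
def IsColoringOn {α : Type*} (s : Finset V) (c : V → α) : Prop :=
  ∀ u ∈ s, ∀ w ∈ s, G.Adj u w → c u ≠ c w

/-- `s` cannot be properly coloured with colours from `α`, but each of its proper subsets can. -/
def IsCriticalOn (α : Type*) (s : Finset V) : Prop :=
  Minimal (fun t : Finset V => ¬ ∃ c : V → α, G.IsColoringOn t c) s

variable {G}

theorem colorable_of_forall_finset {α : Type*} [Finite α] {n : ℕ} (hn : Nat.card α = n)
    (h : ∀ s : Finset V, ∃ c : V → α, G.IsColoringOn s c) : G.Colorable n := by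
  have : Nonempty (G →g (⊤ : SimpleGraph α)) := by
    refine nonempty_hom_of_forall_finite_subgraph_hom fun G' hG' => ?_
    choose c hc using h
    refine ⟨fun x => c hG'.toFinset x, fun {x y} hxy => ?_⟩
    exact hc _ _ (by simp) _ (by simp) (G'.adj_sub hxy)
  obtain ⟨f⟩ := this
  have := Fintype.ofFinite α
  have hc : G.Colorable (Fintype.card α) := Coloring.colorable (α := α) f
  rwa [← Nat.card_eq_fintype_card, hn] at hc

theorem exists_isCriticalOn_subset {α : Type*} {s : Finset V}
    (h : ¬ ∃ c : V → α, G.IsColoringOn s c) : ∃ t ⊆ s, G.IsCriticalOn α t :=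
  exists_minimal_le_of_wellFoundedLT (fun t : Finset V => ¬ ∃ c : V → α, G.IsColoringOn t c) s h

theorem IsCriticalOn.exists_coloring {α : Type*} {s t : Finset V} (h : G.IsCriticalOn α s)
    (hts : t ⊂ s) : ∃ c : V → α, G.IsColoringOn t c := by
  by_contra hc
  exact hts.not_subset (h.2 hc hts.subset)

theorem IsCriticalOn.exists_adj_color_eq [DecidableEq V] {α : Type*} {s : Finset V}
    (h : G.IsCriticalOn α s) {v : V} {c : V → α} (hc : G.IsColoringOn (s.erase v) c) (a : α) :
    ∃ y ∈ s.erase v, G.Adj y v ∧ c y = a := by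
  by_contra! hy
  refine h.1 ⟨Function.update c v a, fun u hu w hw huw => ?_⟩
  by_cases huv : u = v <;> by_cases hwv : w = v
  · subst huv hwv
    exact absurd huw G.irrefl
  · subst huv
    simpa [hwv] using (hy w (by simp [hw, hwv]) huw.symm).symm
  · subst hwv
    simpa [huv] using hy u (by simp [hu, huv]) huw
  · simpa [huv, hwv] using hc u (by simp [hu, huv]) w (by simp [hw, hwv]) huw

theorem IsCriticalOn.nonempty {α : Type*} [Nonempty α] {s : Finset V}
    (h : G.IsCriticalOn α s) : s.Nonempty := by
  rw [Finset.nonempty_iff_ne_empty]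
  rintro rfl
  exact h.1 ⟨fun _ => Classical.arbitrary α, fun u hu => by simp at hu⟩

theorem IsCriticalOn.exists_adj [DecidableEq V] {α : Type*} [Nonempty α] {s : Finset V}
    (h : G.IsCriticalOn α s) {v : V} (hv : v ∈ s) : ∃ y ∈ s, y ≠ v ∧ G.Adj y v := by
  obtain ⟨c, hc⟩ := h.exists_coloring (Finset.erase_ssubset hv)
  obtain ⟨y, hy, hyv, -⟩ := h.exists_adj_color_eq hc (Classical.arbitrary α)
  exact ⟨y, Finset.mem_of_mem_erase hy, Finset.ne_of_mem_erase hy, hyv⟩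

/-- A critical set stays connected when a vertex `x` is deleted. Otherwise it would be the union of
two smaller sets that share only `x` and have no edges between them, and colourings of those two
sets fit together once the colours of one are permuted to agree at `x`. -/
theorem IsCriticalOn.exists_adj_of_ssubset_erase [DecidableEq V] {α : Type*} {s : Finset V}
    (h : G.IsCriticalOn α s) {x : V} (hx : x ∈ s) {T : Finset V} (hT : T ⊂ s.erase x)
    (hne : T.Nonempty) : ∃ u ∈ T, ∃ w ∈ s.erase x, w ∉ T ∧ G.Adj u w := by
  classical
  by_contra! hno
  obtain ⟨z, hz, hzT⟩ := Finset.exists_of_ssubset hT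
  obtain ⟨t, ht⟩ := hne
  have hts := hT.subset ht
  have hxT : x ∉ T := fun hxT => by simpa using hT.subset hxT
  obtain ⟨c₁, hc₁⟩ : ∃ c : V → α, G.IsColoringOn (insert x T) c := by
    refine h.exists_coloring (Finset.ssubset_iff_subset_ne.2 ⟨?_, ?_⟩)
    · exact Finset.insert_subset hx (hT.subset.trans (Finset.erase_subset _ _))
    · rintro rfl
      simp at hz
      tauto
  obtain ⟨c₂, hc₂⟩ : ∃ c : V → α, G.IsColoringOn (s \ T) c := by
    refine h.exists_coloring (Finset.ssubset_iff_subset_ne.2 ⟨Finset.sdiff_subset, ?_⟩)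
    intro he
    have : t ∈ s \ T := he.symm ▸ Finset.mem_of_mem_erase hts
    exact (Finset.mem_sdiff.1 this).2 ht
  let σ := Equiv.swap (c₂ x) (c₁ x)
  have key : ∀ u ∈ s, ∀ w ∈ s, G.Adj u w → u ∈ T → w ∉ T → c₁ u ≠ σ (c₂ w) := by
    intro u hu w hw huw huT hwT
    by_cases hwx : w = x
    · subst hwx
      simpa [σ] using hc₁ u (by simp [huT]) w (by simp) huw
    · exact absurd huw (hno u huT w (by simp [hw, hwx]) hwT)
  refine h.1 ⟨fun u => if u ∈ T then c₁ u else σ (c₂ u), fun u hu w hw huw => ?_⟩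
  by_cases huT : u ∈ T <;> by_cases hwT : w ∈ T <;> simp only [huT, hwT, if_true, if_false]
  · exact hc₁ u (by simp [huT]) w (by simp [hwT]) huw
  · exact key u hu w hw huw huT hwT
  · exact (key w hw u hu huw.symm hwT huT).symm
  · exact fun he => hc₂ u (by simp [hu, huT]) w (by simp [hw, hwT]) huw (σ.injective he)

/-! ### Colourings with ascending paths to all vertices -/

/-- The vertices `y` that can be reached from `a` by a walk inside `s` along which the colour grows
by exactly one at each step. -/
def ascendingSet {k : ℕ} (G : SimpleGraph V) (s : Finset V) (c : V → ZMod k) (a : V) : Set V :=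
  {y | ∃ p : G.Walk a y, (∀ z ∈ p.support, z ∈ s) ∧ ∀ d ∈ p.darts, c d.snd = c d.fst + 1}

theorem Walk.color_end_eq {k : ℕ} {c : V → ZMod k} {a y : V} (p : G.Walk a y)
    (h : ∀ d ∈ p.darts, c d.snd = c d.fst + 1) : c y = c a + p.length := by
  induction p with
  | nil => simp
  | cons hadj q ih =>
    rw [Walk.darts_cons] at h
    have h1 := h _ List.mem_cons_self
    rw [ih fun d hd => h d (List.mem_cons_of_mem _ hd), h1, Walk.length_cons]
    push_cast
    ring

theorem self_mem_ascendingSet {k : ℕ} {s : Finset V} (c : V → ZMod k) {a : V} (ha : a ∈ s) :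
    a ∈ G.ascendingSet s c a :=
  ⟨Walk.nil, by simpa using ha, by simp⟩

theorem ascendingSet_subset {k : ℕ} {s : Finset V} {c : V → ZMod k} {a : V} :
    G.ascendingSet s c a ⊆ s :=
  fun _ ⟨p, hp, _⟩ => hp _ p.end_mem_support

theorem mem_ascendingSet_of_adj {k : ℕ} {s : Finset V} {c : V → ZMod k} {a u w : V}
    (hu : u ∈ G.ascendingSet s c a) (hw : w ∈ s) (huw : G.Adj u w) (hc : c w = c u + 1) :
    w ∈ G.ascendingSet s c a := by
  obtain ⟨p, hps, hpc⟩ := hu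
  refine ⟨p.concat huw, fun z hz => ?_, fun d hd => ?_⟩
  · rw [Walk.support_concat, List.mem_append, List.mem_singleton] at hz
    rcases hz with hz | rfl
    · exact hps z hz
    · exact hw
  · rw [Walk.darts_concat, List.concat_eq_append, List.mem_append, List.mem_singleton] at hd
    rcases hd with hd | rfl
    · exact hpc d hd
    · exact hc

theorem Walk.mem_ascendingSet {k : ℕ} {s : Finset V} {c : V → ZMod k} {a y z : V}
    (p : G.Walk a y) (hps : ∀ z ∈ p.support, z ∈ s)
    (hpc : ∀ d ∈ p.darts, c d.snd = c d.fst + 1) (hz : z ∈ p.support) :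
    z ∈ G.ascendingSet s c a := by
  classical
  exact ⟨p.takeUntil z hz, fun x hx => hps x (p.support_takeUntil_subset_support hz hx),
    fun d hd => hpc d (p.darts_takeUntil_subset_darts hz hd)⟩

open Classical in
/-- The colouring obtained from `c` by adding one to the colours of the ascending set of `a`. -/
noncomputable def shiftColor {k : ℕ} (G : SimpleGraph V) (s : Finset V) (c : V → ZMod k) (a : V) :
    V → ZMod k :=
  fun u => if u ∈ G.ascendingSet s c a then c u + 1 else c u

theorem shiftColor_of_mem {k : ℕ} {s : Finset V} {c : V → ZMod k} {a u : V}
    (hu : u ∈ G.ascendingSet s c a) : shiftColor G s c a u = c u + 1 :=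
  if_pos hu

theorem shiftColor_of_notMem {k : ℕ} {s : Finset V} {c : V → ZMod k} {a u : V}
    (hu : u ∉ G.ascendingSet s c a) : shiftColor G s c a u = c u :=
  if_neg hu

theorem IsColoringOn.shiftColor {k : ℕ} {s : Finset V} {c : V → ZMod k} (a : V)
    (hc : G.IsColoringOn s c) : G.IsColoringOn s (shiftColor G s c a) := by
  intro u hu w hw huw
  by_cases huS : u ∈ G.ascendingSet s c a <;> by_cases hwS : w ∈ G.ascendingSet s c a
  · rw [shiftColor_of_mem huS, shiftColor_of_mem hwS]
    simpa using hc u hu w hw huw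
  · rw [shiftColor_of_mem huS, shiftColor_of_notMem hwS]
    exact fun he => hwS (mem_ascendingSet_of_adj huS hw huw he.symm)
  · rw [shiftColor_of_notMem huS, shiftColor_of_mem hwS]
    exact fun he => huS (mem_ascendingSet_of_adj hwS hu huw.symm he)
  · rw [shiftColor_of_notMem huS, shiftColor_of_notMem hwS]
    exact hc u hu w hw huw

theorem ascendingSet_subset_shiftColor {k : ℕ} {s : Finset V} {c : V → ZMod k} {a : V} :
    G.ascendingSet s c a ⊆ G.ascendingSet s (shiftColor G s c a) a := by
  rintro y ⟨p, hps, hpc⟩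
  refine ⟨p, hps, fun d hd => ?_⟩
  rw [shiftColor_of_mem (p.mem_ascendingSet hps hpc (p.dart_fst_mem_support_of_mem_darts hd)),
    shiftColor_of_mem (p.mem_ascendingSet hps hpc (p.dart_snd_mem_support_of_mem_darts hd)),
    hpc d hd]

/-- Every edge `uw` leaving the ascending set allows it to be enlarged: each shift lowers the gap
`c w - c u` by one, and once the gap is one, `w` has been reached. -/
theorem IsColoringOn.exists_ascendingSet_ssubset {k : ℕ} {s : Finset V} {a u w : V} (hu : u ∈ s)
    (hw : w ∈ s) (huw : G.Adj u w) (d : ℕ) {c : V → ZMod k} (hc : G.IsColoringOn s c)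
    (huS : u ∈ G.ascendingSet s c a) (hwS : w ∉ G.ascendingSet s c a) (hd : c w = c u + d) :
    ∃ c' : V → ZMod k, G.IsColoringOn s c' ∧ G.ascendingSet s c a ⊂ G.ascendingSet s c' a := by
  induction d generalizing c with
  | zero => exact absurd (by simpa using hd.symm) (hc u hu w hw huw)
  | succ d ih =>
    have hsub := ascendingSet_subset_shiftColor (G := G) (s := s) (c := c) (a := a)
    by_cases hwS' : w ∈ G.ascendingSet s (G.shiftColor s c a) a
    · exact ⟨_, hc.shiftColor a, hsub, fun h => hwS (h hwS')⟩
    · obtain ⟨c', hc', hlt⟩ := ih (hc.shiftColor a) (hsub huS) hwS' (by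
        rw [shiftColor_of_mem huS, shiftColor_of_notMem hwS, hd]
        push_cast
        ring)
      exact ⟨c', hc', hsub.trans_ssubset hlt⟩

/-- A connected set that can be coloured with `ZMod k` has a colouring in which every vertex is the
end of a path from `a` whose colours grow by one at each step. Connectedness is expressed by the
absence of a cut. -/
theorem IsColoringOn.exists_forall_exists_isPath {k : ℕ} [NeZero k] {s : Finset V}
    {c₀ : V → ZMod k} (hc₀ : G.IsColoringOn s c₀) {a : V} (ha : a ∈ s)
    (hs : ∀ T ⊂ s, T.Nonempty → ∃ u ∈ T, ∃ w ∈ s, w ∉ T ∧ G.Adj u w) :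
    ∃ c : V → ZMod k, G.IsColoringOn s c ∧ ∀ y ∈ s, ∃ p : G.Walk a y, p.IsPath ∧
      (∀ z ∈ p.support, z ∈ s) ∧ c y = c a + p.length := by
  classical
  -- A colouring whose ascending set has the largest possible size.
  obtain ⟨c, hc, hmax⟩ := WellFounded.has_min
    (measure fun c : V → ZMod k => s.card - (G.ascendingSet s c a).ncard).wf
    {c | G.IsColoringOn s c} ⟨c₀, hc₀⟩
  have hall : G.ascendingSet s c a = s := by
    by_contra hne
    have hfin : (G.ascendingSet s c a).Finite := s.finite_toSet.subset ascendingSet_subset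
    obtain ⟨u, huS, w, hw, hwS, huw⟩ := hs hfin.toFinset
      (by
        rw [Finset.ssubset_iff_subset_ne]
        refine ⟨by simpa using ascendingSet_subset, fun h => hne ?_⟩
        rw [← hfin.coe_toFinset, h])
      ⟨a, by simpa using self_mem_ascendingSet c ha⟩
    rw [hfin.mem_toFinset] at huS hwS
    obtain ⟨c', hc', hlt⟩ := hc.exists_ascendingSet_ssubset (ascendingSet_subset huS) hw huw
      (c w - c u).val huS hwS (by simp)
    refine hmax c' hc' ?_
    have hfin' : (G.ascendingSet s c' a).Finite := s.finite_toSet.subset ascendingSet_subset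
    have h1 := Set.ncard_lt_ncard hlt hfin'
    have h2 := Set.ncard_le_ncard (ascendingSet_subset (G := G) (c := c') (a := a)) s.finite_toSet
    rw [Set.ncard_coe_finset] at h2
    change s.card - _ < s.card - _
    omega
  refine ⟨c, hc, fun y hy => ?_⟩
  have hyS : y ∈ G.ascendingSet s c a := by rw [hall]; exact hy
  obtain ⟨p, hps, hpc⟩ := hyS
  exact ⟨p.bypass, p.bypass_isPath, fun z hz => hps z (p.support_bypass_subset_support hz),
    p.bypass.color_end_eq fun d hd => hpc d (p.darts_bypass_subset_darts hd)⟩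

/-- Any two vertices of a set that is critical for `k` colours are joined inside it by paths of all
lengths modulo `k`. -/
theorem IsCriticalOn.exists_isPath_length_eq {k : ℕ} [NeZero k] {s : Finset V}
    (h : G.IsCriticalOn (ZMod k) s) {a v : V} (ha : a ∈ s) (hv : v ∈ s) (hav : a ≠ v)
    (l : ZMod k) :
    ∃ p : G.Walk a v, p.IsPath ∧ (∀ z ∈ p.support, z ∈ s) ∧ (p.length : ZMod k) = l := by
  classical
  obtain ⟨c₀, hc₀⟩ := h.exists_coloring (Finset.erase_ssubset hv)
  obtain ⟨c, hc, hpath⟩ := hc₀.exists_forall_exists_isPath (a := a) (by simp [ha, hav])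
    fun T hT hne => h.exists_adj_of_ssubset_erase hv hT hne
  -- Every colour occurs on a neighbour of `v`; the path to a suitable one is prolonged to `v`.
  obtain ⟨y, hy, hyv, hcy⟩ := h.exists_adj_color_eq hc (c a + (l - 1))
  obtain ⟨p, hp, hps, hpl⟩ := hpath y hy
  refine ⟨p.concat hyv, hp.concat (fun hvp => by simpa using hps v hvp) hyv, fun z hz => ?_, ?_⟩
  · rw [Walk.support_concat, List.mem_append, List.mem_singleton] at hz
    rcases hz with hz | rfl
    · exact Finset.mem_of_mem_erase (hps z hz)
    · exact hv
  · rw [hpl, add_right_inj] at hcy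
    rw [Walk.length_concat]
    push_cast
    rw [hcy]
    ring

/-! ### Cycles of prescribed length modulo `k` -/

theorem IsCriticalOn.exists_isCycle_of_ne_two {k : ℕ} [NeZero k] {s : Finset V}
    (h : G.IsCriticalOn (ZMod k) s) {r : ZMod k} (hr : r ≠ 2) :
    ∃ (v : V) (C : G.Walk v v), C.IsCycle ∧ (C.length : ZMod k) = r := by
  classical
  obtain ⟨v, hv⟩ := h.nonempty
  obtain ⟨a, ha, hav, hadj⟩ := h.exists_adj hv
  obtain ⟨p, hp, -, hpl⟩ := h.exists_isPath_length_eq ha hv hav (r - 1)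
  refine ⟨v, Walk.cons hadj.symm p, ?_, ?_⟩
  · rw [Walk.cons_isCycle_iff]
    refine ⟨hp, fun he => hr ?_⟩
    rw [hp.length_eq_one_of_mem_edges (Sym2.eq_swap ▸ he)] at hpl
    rw [← sub_add_cancel r 1, ← hpl]
    norm_num
  · rw [Walk.length_cons]
    push_cast
    rw [hpl]
    ring

/-- A critical set for `k` colours lying strictly inside a critical set for a larger palette has an
ear: a path between two of its vertices `b₁`, `b₂` whose interior, from `a₁` to `a₂`, avoids it. -/
theorem IsCriticalOn.exists_ear {α β : Type*} [Nonempty β] {s t : Finset V}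
    (ht : G.IsCriticalOn α t) (hs : G.IsCriticalOn β s) (hst : s ⊂ t) :
    ∃ b₁ ∈ s, ∃ b₂ ∈ s, b₁ ≠ b₂ ∧ ∃ a₁ a₂, G.Adj a₁ b₁ ∧ G.Adj b₂ a₂ ∧
      ∃ q : G.Walk a₂ a₁, q.IsPath ∧ ∀ z ∈ q.support, z ∉ s := by
  classical
  obtain ⟨w, hwt, hws⟩ := Finset.exists_of_ssubset hst
  -- The vertices joined to `w` outside `s`.
  let K : Finset V := t.filter fun u => ∃ p : G.Walk w u, ∀ z ∈ p.support, z ∉ s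
  have hwK : w ∈ K := Finset.mem_filter.2 ⟨hwt, Walk.nil, by simpa using hws⟩
  have attach : ∀ x ∈ s, ∃ b ∈ s, b ≠ x ∧ ∃ a ∈ K, G.Adj a b := by
    intro x hx
    obtain ⟨y, hy, hyx, -⟩ := hs.exists_adj hx
    have hKs : ∀ u ∈ K, u ∉ s := fun u hu => by
      obtain ⟨-, p, hp⟩ := Finset.mem_filter.1 hu
      exact hp u p.end_mem_support
    obtain ⟨a, ha, b, hb, hbK, hab⟩ := ht.exists_adj_of_ssubset_erase (hst.subset hx) (T := K)
      (by
        refine Finset.ssubset_iff_subset_ne.2 ⟨fun u hu => ?_, fun he => ?_⟩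
        · exact Finset.mem_erase.2
            ⟨fun hux => hKs u hu (hux ▸ hx), (Finset.mem_filter.1 hu).1⟩
        · exact hKs y (he ▸ Finset.mem_erase.2 ⟨hyx, hst.subset hy⟩) hy)
      ⟨w, hwK⟩
    refine ⟨b, ?_, Finset.ne_of_mem_erase hb, a, ha, hab⟩
    by_contra hbs
    obtain ⟨-, p, hp⟩ := Finset.mem_filter.1 ha
    refine hbK (Finset.mem_filter.2 ⟨Finset.mem_of_mem_erase hb, p.concat hab, fun z hz => ?_⟩)
    rw [Walk.support_concat, List.mem_append, List.mem_singleton] at hz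
    rcases hz with hz | rfl
    · exact hp z hz
    · exact hbs
  obtain ⟨x, hx⟩ := hs.nonempty
  obtain ⟨b₁, hb₁, -, a₁, ha₁, h₁⟩ := attach x hx
  obtain ⟨b₂, hb₂, hne, a₂, ha₂, h₂⟩ := attach b₁ hb₁
  obtain ⟨-, p₁, hp₁⟩ := Finset.mem_filter.1 ha₁
  obtain ⟨-, p₂, hp₂⟩ := Finset.mem_filter.1 ha₂
  refine ⟨b₁, hb₁, b₂, hb₂, hne.symm, a₁, a₂, h₁, h₂.symm, (p₂.reverse.append p₁).bypass,
    Walk.bypass_isPath _, fun z hz => ?_⟩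
  rcases (Walk.mem_support_append_iff _ _).1 (Walk.support_bypass_subset_support _ hz) with hz | hz
  · exact hp₂ z (by simpa using hz)
  · exact hp₁ z hz

theorem IsCriticalOn.exists_isCycle {k : ℕ} [NeZero k] {α : Type*} {s t : Finset V}
    (ht : G.IsCriticalOn α t) (hs : G.IsCriticalOn (ZMod k) s) (hst : s ⊂ t) (r : ZMod k) :
    ∃ (v : V) (C : G.Walk v v), C.IsCycle ∧ (C.length : ZMod k) = r := by
  obtain ⟨b₁, hb₁, b₂, hb₂, hne, a₁, a₂, h₁, h₂, q, hq, hqs⟩ := ht.exists_ear hs hst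
  obtain ⟨p, hp, hps, hpl⟩ := hs.exists_isPath_length_eq hb₁ hb₂ hne (r - 2 - q.length)
  refine ⟨b₂, Walk.cons h₂ (q.append (Walk.cons h₁ p)), ?_, ?_⟩
  · rw [Walk.cons_isCycle_iff]
    constructor
    · rw [Walk.isPath_def, Walk.support_append, Walk.support_cons, List.tail_cons,
        List.nodup_append]
      exact ⟨hq.support_nodup, hp.support_nodup, fun x hx y hy hxy =>
        hqs x hx (hxy ▸ hps y hy)⟩
    · rw [Walk.edges_append, Walk.edges_cons, List.mem_append, List.mem_cons]
      rintro (h | h | h)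
      · exact hqs _ (q.fst_mem_support_of_mem_edges h) hb₂
      · rw [Sym2.eq_iff] at h
        rcases h with ⟨h, -⟩ | ⟨h, -⟩
        · exact hqs _ q.end_mem_support (h ▸ hb₂)
        · exact hne h.symm
      · exact hqs _ q.start_mem_support (hps _ (p.snd_mem_support_of_mem_edges h))
  · rw [Walk.length_cons, Walk.length_append, Walk.length_cons]
    push_cast
    rw [hpl]
    ring

theorem IsCriticalOn.exists_option_coloring {α : Type*} {s : Finset V}
    (h : G.IsCriticalOn α s) {v : V} (hv : v ∈ s) :
    ∃ c : V → Option α, G.IsColoringOn s c := by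
  classical
  obtain ⟨c, hc⟩ := h.exists_coloring (Finset.erase_ssubset hv)
  refine ⟨fun u => if u = v then none else some (c u), fun u hu w hw huw => ?_⟩
  by_cases huv : u = v <;> by_cases hwv : w = v
  · subst huv hwv
    exact absurd huw G.irrefl
  · simp [huv, hwv]
  · simp [huv, hwv]
  · simpa [huv, hwv] using hc u (by simp [hu, huv]) w (by simp [hw, hwv]) huw

end SimpleGraph

open SimpleGraph in
theorem theorem4 {V : Type*} (G : SimpleGraph V) (k r : ℕ) (hk : 2 ≤ k) (hr1 : 1 ≤ r) (hrk : r ≤ k)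
    (hG : ∀ (v : V) (C : G.Walk v v), C.IsCycle → ¬ C.length ≡ r [MOD k]) :
    (r ≠ 2 → G.Colorable k) ∧ (r = 2 → G.Colorable (k + 1)) := by
  have : NeZero k := ⟨by omega⟩
  have hG' : ¬ ∃ (v : V) (C : G.Walk v v), C.IsCycle ∧ (C.length : ZMod k) = (r : ℕ) :=
    fun ⟨v, C, hC, hl⟩ => hG v C hC ((ZMod.natCast_eq_natCast_iff _ _ _).1 hl)
  constructor
  · intro hr
    refine colorable_of_forall_finset (α := ZMod k) (by simp) fun s => ?_
    by_contra hs
    obtain ⟨t, -, ht⟩ := exists_isCriticalOn_subset hs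
    refine hG' (ht.exists_isCycle_of_ne_two fun h => hr ?_)
    have h2 : r ≡ 2 [MOD k] := (ZMod.natCast_eq_natCast_iff _ _ _).1 (by exact_mod_cast h)
    exact h2.eq_of_abs_lt (abs_lt.2 (by omega))
  · intro _
    refine colorable_of_forall_finset (α := Option (ZMod k)) (by simp) fun s => ?_
    by_contra hs
    obtain ⟨t, -, ht⟩ := exists_isCriticalOn_subset hs
    obtain ⟨u, hut, hu⟩ := exists_isCriticalOn_subset (α := ZMod k) (G := G) (s := t)
      fun ⟨c, hc⟩ => ht.1 ⟨fun x => some (c x), fun x hx y hy hxy => by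
        simpa using hc x hx y hy hxy⟩
    refine hG' (ht.exists_isCycle hu (Finset.ssubset_iff_subset_ne.2 ⟨hut, ?_⟩) _)
    rintro rfl
    obtain ⟨v, hv⟩ := hu.nonempty
    exact ht.1 (hu.exists_option_coloring hv)
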